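/- Let $K$ be a field, $L$ a finite cyclic Galois extension of $K$ of degree $n$, and $\sigma$ a generator of $\mathrm{Gal}(L/K)$. Let $L[x;\sigma]$ be the skew polynomial ring, whose elements are the polynomials $\sum_i a_i x^i$ with $a_i\in L$, with the usual addition and with the multiplication determined by $xa=\sigma(a)x$ for $a\in L$. Let $N:L\to K$, $N(a)=\prod_{i=0}^{n-1}\sigma^i(a)$, be the norm map. Let $F\in K[y]$ be a monic irreducible polynomial of degree $s$ with constant coefficient $F_0$, let $k\ge 0$ be an integer, and let $g\in L[x;\sigma]$ be a monic polynomial of degree $sk$ with constant coefficient $g_0$ such that $F(x^n)=hg$ for some $h\in L[x;\sigma]$. Then $$N(g_0)=(-1)^{ks(n-1)}F_0^{\,k}.$$ -/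

import Mathlib

noncomputable section

/-- The action of `ℕ` on `L` in which `i` acts as the `i`-th power of `σ`. -/
abbrev twistAction {K L : Type*} [Field K] [Field L] [Algebra K L] (σ : L ≃ₐ[K] L) :
    MulSemiringAction (Multiplicative ℕ) L :=
  MulSemiringAction.compHom L (powersHom (L ≃ₐ[K] L) σ)

/-- The skew polynomial ring `L[x;σ]`: finite sums `∑ aᵢ xⁱ` with `aᵢ ∈ L`, coefficientwise
addition, and the multiplication determined by `x a = σ(a) x`. -/
def SkewPolyRing {K L : Type*} [Field K] [Field L] [Algebra K L] (_σ : L ≃ₐ[K] L) : Type _ :=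
  SkewPolynomial L

namespace SkewPolyRing

variable {K L : Type*} [Field K] [Field L] [Algebra K L] {σ : L ≃ₐ[K] L}

instance instRing (σ : L ≃ₐ[K] L) : Ring (SkewPolyRing σ) :=
  letI := twistAction σ
  inferInstanceAs (Ring (SkewPolynomial L))

/-- The coefficient of `xⁱ`. -/
def coeff (g : SkewPolyRing σ) (i : ℕ) : L := SkewPolynomial.coeff g i

/-- The degree (with value `0` at the zero polynomial). -/
def natDegree (g : SkewPolyRing σ) : ℕ := (SkewPolynomial.support g).sup id

/-- `g` is monic: its leading coefficient is `1`. -/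
def Monic (g : SkewPolyRing σ) : Prop := g.coeff g.natDegree = 1

/-- The embedding of `L` as the constants of `L[x;σ]`. -/
def C (σ : L ≃ₐ[K] L) : L →+* SkewPolyRing σ :=
  letI := twistAction σ
  SkewPolynomial.CRingHom

/-- The indeterminate `x`. -/
def X (σ : L ≃ₐ[K] L) : SkewPolyRing σ := (SkewPolynomial.X : SkewPolynomial L)

/-- For `F ∈ K[y]`, the element `F(xⁿ)` of `L[x;σ]`. -/
def evalXPow (σ : L ≃ₐ[K] L) (n : ℕ) (F : Polynomial K) : SkewPolyRing σ :=
  F.eval₂ ((C σ).comp (algebraMap K L)) (X σ ^ n)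

/-- `g` is a right divisor of `f`: `f = h g` for some `h`. -/
def IsRightDivisor (g f : SkewPolyRing σ) : Prop := ∃ h : SkewPolyRing σ, f = h * g

/-- The commutation rule of `L[x;σ]`. -/
theorem X_mul_C (σ : L ≃ₐ[K] L) (a : L) : X σ * C σ a = C σ (σ a) * X σ := by
  let _ := twistAction σ
  have key : (SkewPolynomial.X * SkewPolynomial.C a : SkewPolynomial L)
      = SkewPolynomial.C (σ a) * SkewPolynomial.X := by
    rw [← SkewPolynomial.monomial_zero_left, ← SkewPolynomial.monomial_zero_left,
      SkewPolynomial.X_mul_monomial, SkewPolynomial.monomial_mul_X]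
    congr 1
  exact key

end SkewPolyRing

end

/-!
Let `n = [L : K]` and `G = Gal(L/K)`. The ring `L[x;σ]` acts on a free module over `L[t]` with basis
indexed by `G`: a scalar `a` acts as the diagonal matrix of its conjugates `τ(a)`, and `x` as `t`
times the permutation matrix of right translation by `σ`. The determinant of this representation is
a polynomial in `tⁿ` (because the `(τ, υ)` entry only involves powers `tʲ` with `τσʲ = υ`) with
coefficients in `K` (because conjugating the coefficients by `ρ ∈ G` merely translates the index set
by `ρ`). Read as a polynomial in `y = tⁿ`, it is the reduced norm `L[x;σ] → K[y]`: a multiplicative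
map that preserves degrees, sends `F(xⁿ)` to `Fⁿ`, and sends `g` to a polynomial with constant
coefficient `N(g₀)`. For `g` of degree `d` the leading coefficient becomes its norm times the `d`-th
power of the sign of an `n`-cycle, right translation by `σ` being such a cycle.

If `g` right divides `F(xⁿ)`, its reduced norm divides `Fⁿ`, hence is a constant times a power of
the irreducible `F`; comparing degrees, leading coefficients and constant coefficients gives the
formula.
-/

noncomputable section

open Polynomial Equiv.Perm

section Grading

variable {R : Type*} [CommSemiring R]

variable (R) in
/-- The component of degree `r` in the `ℤ/n`-grading of `R[X]`: the polynomials in which `Xʲ` occurs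
only for `j ≡ r` modulo `n`. -/
def residueGrade (n : ℕ) (r : ZMod n) : Submodule R R[X] :=
  (AddMonoidAlgebra.gradeBy R (Nat.castAddMonoidHom (ZMod n)) r).comap
    (toFinsuppIsoLinear R).toLinearMap

theorem mem_residueGrade {n : ℕ} {r : ZMod n} {p : R[X]} :
    p ∈ residueGrade R n r ↔ ∀ j : ℕ, p.coeff j ≠ 0 → (j : ZMod n) = r := by
  simp only [← mem_support_iff]
  rfl

instance residueGrade.gradedMonoid (n : ℕ) : SetLike.GradedMonoid (residueGrade R n) where
  one_mem := mem_residueGrade.2 fun j hj => by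
    obtain rfl : j = 0 := by
      by_contra h
      exact hj (by rw [coeff_one, if_neg h])
    exact Nat.cast_zero
  mul_mem r s p q hp hq := mem_residueGrade.2 fun j hj => by
    rw [coeff_mul] at hj
    obtain ⟨⟨a, b⟩, hab, hne⟩ := Finset.exists_ne_zero_of_sum_ne_zero hj
    rw [← Finset.HasAntidiagonal.mem_antidiagonal.1 hab, Nat.cast_add,
      mem_residueGrade.1 hp a (left_ne_zero_of_mul hne),
      mem_residueGrade.1 hq b (right_ne_zero_of_mul hne)]

theorem expand_contract_of_mem_residueGrade_zero {n : ℕ} (hn : n ≠ 0) {p : R[X]}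
    (hp : p ∈ residueGrade R n 0) : expand R n (contract n p) = p := by
  ext j
  rw [coeff_expand hn.bot_lt, coeff_contract hn]
  split_ifs with hj
  · rw [Nat.div_mul_cancel hj]
  · by_contra hne
    exact hj ((ZMod.natCast_eq_zero_iff j n).1 (mem_residueGrade.1 hp j (Ne.symm hne)))

end Grading

theorem expand_finrank_map_injective (K L : Type*) [Field K] [Field L] [Algebra K L]
    [FiniteDimensional K L] :
    Function.Injective fun P : K[X] => expand L (Module.finrank K L) (P.map (algebraMap K L)) :=
  (expand_injective Module.finrank_pos).comp (map_injective _ (algebraMap K L).injective)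

section Determinant

variable {R ι : Type*} [CommRing R] [Fintype ι] [DecidableEq ι]

theorem det_mem_residueGrade_zero {n : ℕ} (w : ι → ZMod n) {M : Matrix ι ι R[X]}
    (hM : ∀ i j, M i j ∈ residueGrade R n (w j - w i)) : M.det ∈ residueGrade R n 0 := by
  rw [Matrix.det_apply]
  refine Submodule.sum_mem _ fun π _ => ?_
  have hprod := SetLike.prod_mem_graded (residueGrade R n) (fun i => w i - w (π i))
    (fun i => M (π i) i) (F := Finset.univ) fun i _ => hM _ _
  rw [Finset.sum_sub_distrib, Equiv.sum_comp π w, sub_self] at hprod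
  rw [Units.smul_def]
  exact zsmul_mem hprod _

theorem natDegree_det_le_card_mul {M : Matrix ι ι R[X]} {d : ℕ}
    (hM : ∀ i j, (M i j).natDegree ≤ d) : M.det.natDegree ≤ Fintype.card ι * d := by
  rw [Matrix.det_apply]
  refine natDegree_sum_le_of_forall_le _ _ fun π _ => ?_
  calc (sign π • ∏ i, M (π i) i).natDegree
      ≤ (∏ i, M (π i) i).natDegree := natDegree_smul_le _ _
    _ ≤ ∑ i, (M (π i) i).natDegree := natDegree_prod_le _ _
    _ ≤ Fintype.card ι * d := Finset.sum_le_card_nsmul _ _ d fun i _ => hM _ _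

theorem coeff_det_card_mul {M : Matrix ι ι R[X]} {d : ℕ}
    (hM : ∀ i j, (M i j).natDegree ≤ d) :
    M.det.coeff (Fintype.card ι * d) = (M.map (coeff · d)).det := by
  simp only [Matrix.det_apply, finsetSum_coeff, Units.smul_def, coeff_smul, Matrix.map_apply,
    ← Finset.card_univ, coeff_prod_of_natDegree_le _ _ _ fun i _ => hM _ i]

end Determinant

theorem permMatrix_pow {R ι : Type*} [Semiring R] [Fintype ι] [DecidableEq ι]
    (π : Equiv.Perm ι) (j : ℕ) : π.permMatrix R ^ j = (π ^ j).permMatrix R := by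
  induction j with
  | zero => simp
  | succ j ih => rw [pow_succ, ih, pow_succ', Matrix.permMatrix_mul]

theorem sign_mulRight_of_forall_mem_zpowers {G : Type*} [Group G] [Fintype G] [DecidableEq G]
    {g : G} (hg : ∀ x, x ∈ Subgroup.zpowers g) :
    sign (Equiv.mulRight g) = (-1) ^ (Fintype.card G - 1) := by
  obtain rfl | hne := eq_or_ne g 1
  · have : Subsingleton G := subsingleton_of_forall_eq 1 fun x => by simpa using hg x
    simp [Fintype.card_le_one_iff_subsingleton.2 this]
  have hcycle : (Equiv.mulRight g).IsCycle := by
    refine ⟨1, by simpa, fun y _ => ?_⟩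
    obtain ⟨j, rfl⟩ := hg y
    exact ⟨j, by simp⟩
  have hsupport : (Equiv.mulRight g).support = Finset.univ := by
    ext x
    simpa
  rw [hcycle.sign, hsupport, Finset.card_univ]
  obtain ⟨m, hm⟩ := Nat.exists_eq_succ_of_ne_zero (Fintype.card_ne_zero (α := G))
  simp [hm, pow_succ]

theorem eq_C_mul_pow_of_dvd_pow {K : Type*} [Field K] {F P : K[X]} (hF : F.Monic)
    (hFirr : Irreducible F) {k m : ℕ} (hdvd : P ∣ F ^ m) (hdeg : P.natDegree = F.natDegree * k) :
    P = C P.leadingCoeff * F ^ k := by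
  obtain ⟨j, -, hPj⟩ := (dvd_prime_pow hFirr.prime m).1 hdvd
  obtain ⟨u, hu⟩ := hPj.symm
  obtain ⟨c, hc, hcu⟩ := Polynomial.isUnit_iff.1 u.isUnit
  obtain rfl : P = C c * F ^ j := by rw [hcu, mul_comm, hu]
  rw [natDegree_C_mul hc.ne_zero, hF.natDegree_pow, mul_comm] at hdeg
  rw [Nat.eq_of_mul_eq_mul_left hFirr.natDegree_pos hdeg, leadingCoeff_mul, leadingCoeff_C,
    (hF.pow k).leadingCoeff, mul_one]

namespace SkewPolyRing

variable {K L : Type*} [Field K] [Field L] [Algebra K L] {σ : Gal(L/K)}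

theorem coeff_add (g h : SkewPolyRing σ) (j : ℕ) : (g + h).coeff j = g.coeff j + h.coeff j :=
  SkewPolynomial.coeff_add g h j

theorem C_mul_X_pow_eq_monomial (a : L) (i : ℕ) :
    C σ a * X σ ^ i = (SkewPolynomial.monomial i a : SkewPolynomial L) := by
  let := twistAction σ
  have hmonomial : (SkewPolynomial.C a * SkewPolynomial.X ^ i : SkewPolynomial L) =
      SkewPolynomial.monomial i a :=
    SkewPolynomial.C_mul_X_pow_eq_monomial (R := L) (a := a) (n := i)
  exact hmonomial

theorem coeff_C_mul_X_pow (a : L) (i j : ℕ) :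
    (C σ a * X σ ^ i).coeff j = if i = j then a else 0 := by
  rw [C_mul_X_pow_eq_monomial]
  exact SkewPolynomial.coeff_monomial

theorem coeff_eq_zero_of_natDegree_lt (g : SkewPolyRing σ) {j : ℕ} (hj : g.natDegree < j) :
    g.coeff j = 0 := by
  by_contra h
  exact hj.not_ge (Finset.le_sup (f := id) (SkewPolynomial.mem_support_iff.2 h))

theorem coeff_natDegree_ne_zero {g : SkewPolyRing σ} (hg : g ≠ 0) :
    g.coeff g.natDegree ≠ 0 := by
  have hsupport : (SkewPolynomial.support g).Nonempty :=
    Finset.nonempty_iff_ne_empty.2 (mt SkewPolynomial.support_eq_empty.1 hg)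
  obtain ⟨i, hi, hsup⟩ := Finset.exists_mem_eq_sup _ hsupport id
  rw [natDegree, hsup]
  exact SkewPolynomial.mem_support_iff.1 hi

theorem induction_on {p : SkewPolyRing σ → Prop} (g : SkewPolyRing σ)
    (add : ∀ g h, p g → p h → p (g + h)) (C_mul_X_pow : ∀ a i, p (C σ a * X σ ^ i)) : p g := by
  simp only [C_mul_X_pow_eq_monomial] at C_mul_X_pow
  refine SkewPolynomial.induction (motive := p) g ?_ fun i a f _ _ hf =>
    add _ _ (C_mul_X_pow a i) hf
  simpa using! C_mul_X_pow 0 0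

section Lift

variable {R : Type*} [Semiring R]

/-- The universal property of `L[x;σ]`: the extension of a ring homomorphism `f` on the scalars by
`x ↦ r`, for `r` satisfying the commutation rule. -/
def lift (f : L →+* R) (r : R) (hr : ∀ a, r * f a = f (σ a) * r) :
    SkewPolyRing σ →+* R :=
  letI := twistAction σ
  SkewMonoidAlgebra.liftNCRingHom f (powersHom R r) fun {a y} => by
    change f ((σ ^ y.toAdd) a) * r ^ y.toAdd = r ^ y.toAdd * f a
    induction y.toAdd with
    | zero => simp
    | succ j ih =>
      rw [pow_succ', pow_succ', AlgEquiv.mul_apply, ← mul_assoc, ← hr, mul_assoc, ih, mul_assoc]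

variable {f : L →+* R} {r : R} (hr : ∀ a, r * f a = f (σ a) * r)

theorem lift_C (a : L) : lift f r hr (C σ a) = f a :=
  (SkewMonoidAlgebra.liftNC_single (f : L →+ R) (powersHom R r) 1 a).trans (by simp)

theorem lift_X : lift f r hr (X σ) = r :=
  (SkewMonoidAlgebra.liftNC_single (f : L →+ R) (powersHom R r) (.ofAdd 1) 1).trans (by simp)

end Lift

section RegularRep

variable [Fintype Gal(L/K)] [DecidableEq Gal(L/K)]

/-- The representation of `L[x;σ]` by matrices over `L[X]` indexed by the Galois group in which
`a : L` acts as the diagonal matrix of its conjugates and `x` has the entry `X` at each position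
`(τ, τ * σ)`. For `σ` of order `n`, the central element `xⁿ` acts as the scalar `Xⁿ`. -/
def regularRep (σ : Gal(L/K)) :
    SkewPolyRing σ →+* Matrix Gal(L/K) Gal(L/K) L[X] :=
  lift
    ((Matrix.diagonalRingHom Gal(L/K) L[X]).comp
      (RingHom.pi fun τ => Polynomial.C.comp (τ : L →+* L)))
    ((Polynomial.X : L[X]) • (Equiv.mulRight σ).permMatrix L[X]) fun a => by
    ext τ υ : 2
    by_cases hυ : τ * σ = υ
    · subst hυ
      simp [Equiv.Perm.permMatrix, PEquiv.toMatrix_apply]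
    · simp [Equiv.Perm.permMatrix, PEquiv.toMatrix_apply, hυ]

theorem regularRep_C_mul_X_pow_apply (a : L) (i : ℕ) (τ υ : Gal(L/K)) :
    regularRep σ (C σ a * X σ ^ i) τ υ = if υ = τ * σ ^ i then monomial i (τ a) else 0 := by
  rw [map_mul, map_pow, regularRep, lift_C, lift_X, _root_.smul_pow, permMatrix_pow,
    Equiv.pow_mulRight]
  simp [Equiv.Perm.permMatrix, PEquiv.toMatrix_apply, Matrix.diagonal_mul,
    ← Polynomial.C_mul_X_pow_eq_monomial, eq_comm]

theorem coeff_regularRep_apply (g : SkewPolyRing σ) (τ υ : Gal(L/K)) (j : ℕ) :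
    (regularRep σ g τ υ).coeff j = if υ = τ * σ ^ j then τ (g.coeff j) else 0 := by
  induction g using induction_on with
  | add g h hg hh =>
    simp only [map_add, Matrix.add_apply, Polynomial.coeff_add, coeff_add, hg, hh]
    split_ifs <;> simp
  | C_mul_X_pow a i =>
    rw [regularRep_C_mul_X_pow_apply, coeff_C_mul_X_pow]
    obtain rfl | hij := eq_or_ne i j
    · rw [if_pos rfl]
      split_ifs <;> simp
    · split_ifs <;> simp [coeff_monomial, hij]

theorem natDegree_regularRep_apply_le (g : SkewPolyRing σ) (τ υ : Gal(L/K)) :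
    (regularRep σ g τ υ).natDegree ≤ g.natDegree := by
  refine natDegree_le_iff_coeff_eq_zero.2 fun j hj => ?_
  rw [coeff_regularRep_apply, coeff_eq_zero_of_natDegree_lt g hj, map_zero, ite_self]

theorem regularRep_apply_mem_residueGrade {n : ℕ} (χ : Gal(L/K) →* Multiplicative (ZMod n))
    (hχ : χ σ = .ofAdd 1) (g : SkewPolyRing σ) (τ υ : Gal(L/K)) :
    regularRep σ g τ υ ∈ residueGrade L n ((χ υ).toAdd - (χ τ).toAdd) := by
  refine mem_residueGrade.2 fun j hj => ?_
  rw [coeff_regularRep_apply] at hj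
  obtain rfl : υ = τ * σ ^ j := by
    by_contra h
    exact hj (if_neg h)
  simp [hχ]

theorem regularRep_evalXPow {n : ℕ} (hn : σ ^ n = 1) (F : K[X]) :
    regularRep σ (evalXPow σ n F) =
      Matrix.scalar Gal(L/K) (expand L n (F.map (algebraMap K L))) := by
  have hX : regularRep σ (X σ ^ n) = Matrix.scalar _ (Polynomial.X ^ n) := by
    ext τ υ : 2
    rw [← one_mul (X σ ^ n), ← map_one (C σ), regularRep_C_mul_X_pow_apply, hn]
    simp [monomial_one_right_eq_X_pow, Matrix.diagonal_apply, eq_comm]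
  have hC : (regularRep σ).comp ((C σ).comp (algebraMap K L)) =
      (Matrix.scalar Gal(L/K)).comp (Polynomial.C.comp (algebraMap K L)) := by
    refine RingHom.ext fun a => Matrix.ext fun τ υ => ?_
    simpa [Matrix.diagonal_apply, eq_comm] using
      regularRep_C_mul_X_pow_apply (σ := σ) (algebraMap K L a) 0 τ υ
  rw [evalXPow, hom_eval₂, hX, hC, ← hom_eval₂, expand_eq_comp_X_pow, comp, eval₂_map]

theorem map_det_regularRep (g : SkewPolyRing σ) (ρ : Gal(L/K)) :
    (regularRep σ g).det.map (ρ : L →+* L) = (regularRep σ g).det := by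
  have hmap : (mapRingHom (ρ : L →+* L)).mapMatrix (regularRep σ g) =
      (regularRep σ g).submatrix (Equiv.mulLeft ρ) (Equiv.mulLeft ρ) := by
    ext τ υ j
    simp only [RingHom.mapMatrix_apply, Matrix.map_apply, coe_mapRingHom, coeff_map,
      Matrix.submatrix_apply, coeff_regularRep_apply, Equiv.coe_mulLeft, mul_assoc, mul_right_inj]
    split_ifs <;> simp
  rw [← coe_mapRingHom, RingHom.map_det, hmap, Matrix.det_submatrix_equiv_self]

theorem coeff_zero_det_regularRep (g : SkewPolyRing σ) :
    (regularRep σ g).det.coeff 0 = ∏ τ : Gal(L/K), τ (g.coeff 0) := by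
  have hconst : constantCoeff.mapMatrix (regularRep σ g) =
      Matrix.diagonal fun τ => τ (g.coeff 0) := by
    ext τ υ
    simp [Matrix.diagonal_apply, coeff_regularRep_apply, eq_comm]
  rw [← constantCoeff_apply, RingHom.map_det, hconst, Matrix.det_diagonal]

theorem coeff_card_mul_natDegree_det_regularRep (hσ : ∀ τ, τ ∈ Subgroup.zpowers σ)
    (g : SkewPolyRing σ) :
    (regularRep σ g).det.coeff (Fintype.card Gal(L/K) * g.natDegree) =
      (-1) ^ (g.natDegree * (Fintype.card Gal(L/K) - 1)) *
        ∏ τ : Gal(L/K), τ (g.coeff g.natDegree) := by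
  have htop : (regularRep σ g).map (Polynomial.coeff · g.natDegree) =
      Matrix.diagonal (fun τ => τ (g.coeff g.natDegree)) *
        (Equiv.mulRight σ ^ g.natDegree).permMatrix L := by
    ext τ υ
    simp [coeff_regularRep_apply, Equiv.pow_mulRight, Equiv.Perm.permMatrix,
      PEquiv.toMatrix_apply, Matrix.diagonal_mul, eq_comm]
  rw [coeff_det_card_mul (natDegree_regularRep_apply_le g), htop, Matrix.det_mul,
    Matrix.det_diagonal, Matrix.det_permutation, map_pow,
    sign_mulRight_of_forall_mem_zpowers hσ, mul_comm, mul_comm g.natDegree, pow_mul]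
  simp

variable [FiniteDimensional K L] [IsGalois K L]

theorem det_regularRep_mem_residueGrade_zero (hσ : ∀ τ, τ ∈ Subgroup.zpowers σ)
    (g : SkewPolyRing σ) : (regularRep σ g).det ∈ residueGrade L (Module.finrank K L) 0 := by
  let χ := (zmodMulEquivOfGenerator hσ (IsGalois.card_aut_eq_finrank K L)).symm
  have hχ : χ σ = .ofAdd 1 := by
    have h := zmodMulEquivOfGenerator_symm_apply_zpow hσ (IsGalois.card_aut_eq_finrank K L) 1
    rwa [zpow_one, Int.cast_one] at h
  exact det_mem_residueGrade_zero _ (regularRep_apply_mem_residueGrade χ.toMonoidHom hχ g)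

theorem exists_expand_map_eq_det_regularRep (hσ : ∀ τ, τ ∈ Subgroup.zpowers σ)
    (g : SkewPolyRing σ) :
    ∃ P : K[X], expand L (Module.finrank K L) (P.map (algebraMap K L)) = (regularRep σ g).det := by
  have hn : Module.finrank K L ≠ 0 := Module.finrank_pos.ne'
  have hfixed (j : ℕ) : (regularRep σ g).det.coeff j ∈ Set.range (algebraMap K L) := by
    refine (IsGalois.mem_range_algebraMap_iff_fixed _).2 fun ρ => ?_
    conv_rhs => rw [← map_det_regularRep g ρ]
    simp
  have hlift : contract (Module.finrank K L) (regularRep σ g).det ∈ lifts (algebraMap K L) := by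
    refine (lifts_iff_coeff_lifts _).2 fun j => ?_
    rw [coeff_contract hn]
    exact hfixed _
  obtain ⟨P, hP⟩ := (mem_lifts _).1 hlift
  refine ⟨P, ?_⟩
  rw [hP, expand_contract_of_mem_residueGrade_zero hn (det_regularRep_mem_residueGrade_zero hσ g)]

end RegularRep

section ReducedNorm

variable [FiniteDimensional K L] [IsGalois K L] (hσ : ∀ τ, τ ∈ Subgroup.zpowers σ)

open Classical in
/-- The reduced norm `L[x;σ] → K[y]`, where `y` stands for the central element `xⁿ` and
`n = [L : K]`: the determinant of the regular representation, which is a polynomial in `Xⁿ` with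
coefficients in `K`. -/
def reducedNorm : SkewPolyRing σ →*₀ K[X] where
  toFun g := (exists_expand_map_eq_det_regularRep hσ g).choose
  map_zero' := expand_finrank_map_injective K L <|
    (exists_expand_map_eq_det_regularRep hσ 0).choose_spec.trans (by simp)
  map_one' := expand_finrank_map_injective K L <|
    (exists_expand_map_eq_det_regularRep hσ 1).choose_spec.trans (by simp)
  map_mul' g h := expand_finrank_map_injective K L <| by
    simp only [Polynomial.map_mul, map_mul (expand L _),
      (exists_expand_map_eq_det_regularRep hσ _).choose_spec]
    rw [map_mul, Matrix.det_mul]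

open Classical in
theorem expand_map_reducedNorm (g : SkewPolyRing σ) :
    expand L (Module.finrank K L) ((reducedNorm hσ g).map (algebraMap K L)) =
      (regularRep σ g).det :=
  (exists_expand_map_eq_det_regularRep hσ g).choose_spec

open Classical in
theorem algebraMap_coeff_reducedNorm (g : SkewPolyRing σ) (j : ℕ) :
    algebraMap K L ((reducedNorm hσ g).coeff j) =
      (regularRep σ g).det.coeff (Module.finrank K L * j) := by
  rw [← expand_map_reducedNorm hσ, coeff_expand_mul' Module.finrank_pos, coeff_map]

theorem reducedNorm_evalXPow (F : K[X]) :
    reducedNorm hσ (evalXPow σ (Module.finrank K L) F) = F ^ Module.finrank K L := by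
  classical
  have hpow : σ ^ Module.finrank K L = 1 := by
    rw [← IsGalois.card_aut_eq_finrank, pow_card_eq_one']
  refine expand_finrank_map_injective K L ?_
  simp only [expand_map_reducedNorm, regularRep_evalXPow hpow]
  simp [← Nat.card_eq_fintype_card, IsGalois.card_aut_eq_finrank]

theorem natDegree_reducedNorm_le (g : SkewPolyRing σ) :
    (reducedNorm hσ g).natDegree ≤ g.natDegree := by
  classical
  have h := natDegree_det_le_card_mul (natDegree_regularRep_apply_le g)
  rw [← expand_map_reducedNorm hσ, natDegree_expand, natDegree_map, ← Nat.card_eq_fintype_card,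
    IsGalois.card_aut_eq_finrank, mul_comm] at h
  exact Nat.le_of_mul_le_mul_left h Module.finrank_pos

theorem coeff_natDegree_reducedNorm (g : SkewPolyRing σ) :
    (reducedNorm hσ g).coeff g.natDegree =
      (-1) ^ (g.natDegree * (Module.finrank K L - 1)) *
        Algebra.norm K (g.coeff g.natDegree) := by
  classical
  apply (algebraMap K L).injective
  have h := coeff_card_mul_natDegree_det_regularRep hσ g
  rw [← Nat.card_eq_fintype_card, IsGalois.card_aut_eq_finrank] at h
  rw [algebraMap_coeff_reducedNorm, h, ← Algebra.norm_eq_prod_automorphisms]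
  simp

theorem natDegree_reducedNorm {g : SkewPolyRing σ} (hg : g ≠ 0) :
    (reducedNorm hσ g).natDegree = g.natDegree := by
  refine natDegree_eq_of_le_of_coeff_ne_zero (natDegree_reducedNorm_le hσ g) ?_
  rw [coeff_natDegree_reducedNorm]
  exact mul_ne_zero (by simp) (Algebra.norm_ne_zero_iff.2 (coeff_natDegree_ne_zero hg))

theorem coeff_zero_reducedNorm (g : SkewPolyRing σ) :
    (reducedNorm hσ g).coeff 0 = Algebra.norm K (g.coeff 0) := by
  classical
  apply (algebraMap K L).injective
  rw [algebraMap_coeff_reducedNorm, mul_zero, coeff_zero_det_regularRep,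
    Algebra.norm_eq_prod_automorphisms]

end ReducedNorm

end SkewPolyRing

open SkewPolyRing in
theorem mainTheorem8_general {K L : Type*} [Field K] [Field L] [Algebra K L]
    [FiniteDimensional K L] [IsGalois K L]
    (σ : Gal(L/K)) (hσ : ∀ τ : Gal(L/K), τ ∈ Subgroup.zpowers σ)
    (F : K[X]) (hF : F.Monic) (hFirr : Irreducible F) (k : ℕ)
    (g : SkewPolyRing σ) (hgdeg : g.natDegree = F.natDegree * k) (m : ℕ)
    (hgdvd : g.IsRightDivisor (evalXPow σ (Module.finrank K L) F ^ m)) :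
    Algebra.norm K (g.coeff 0) =
      (-1) ^ (k * F.natDegree * (Module.finrank K L - 1)) * Algebra.norm K (g.coeff g.natDegree) *
        F.coeff 0 ^ k := by
  have hdvd : reducedNorm hσ g ∣ F ^ (Module.finrank K L * m) := by
    obtain ⟨h, hh⟩ := hgdvd
    rw [pow_mul, ← reducedNorm_evalXPow hσ F, ← map_pow, hh, map_mul]
    exact dvd_mul_left _ _
  have hg : g ≠ 0 := by
    rintro rfl
    exact pow_ne_zero _ hF.ne_zero (zero_dvd_iff.1 (map_zero (reducedNorm hσ) ▸ hdvd))
  have hlead : (reducedNorm hσ g).leadingCoeff =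
      (-1) ^ (k * F.natDegree * (Module.finrank K L - 1)) *
        Algebra.norm K (g.coeff g.natDegree) := by
    rw [leadingCoeff, natDegree_reducedNorm hσ hg, coeff_natDegree_reducedNorm,
      mul_comm k, ← hgdeg]
  have hpow : reducedNorm hσ g = Polynomial.C (reducedNorm hσ g).leadingCoeff * F ^ k :=
    eq_C_mul_pow_of_dvd_pow hF hFirr hdvd ((natDegree_reducedNorm hσ hg).trans hgdeg)
  rw [← coeff_zero_reducedNorm hσ, ← hlead, hpow, leadingCoeff_mul, coeff_C_mul]
  simp [coeff_zero_eq_eval_zero, hF.leadingCoeff]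

end

theorem mainTheorem8 {K L : Type*} [Field K] [Field L] [Algebra K L]
    [FiniteDimensional K L] [IsGalois K L]
    (n : ℕ) (hn : Module.finrank K L = n)
    (σ : L ≃ₐ[K] L) (hσ : ∀ τ : L ≃ₐ[K] L, τ ∈ Subgroup.zpowers σ)
    (F : Polynomial K) (hFmonic : F.Monic) (hFirr : Irreducible F)
    (s : ℕ) (hs : F.natDegree = s) (k : ℕ)
    (g : SkewPolyRing σ) (hgmonic : g.Monic) (hgdeg : g.natDegree = s * k)
    (hgdvd : g.IsRightDivisor (SkewPolyRing.evalXPow σ n F)) :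
    Algebra.norm K (g.coeff 0) = (-1) ^ (k * s * (n - 1)) * F.coeff 0 ^ k := by
  subst hn hs
  have hpow : g.IsRightDivisor (SkewPolyRing.evalXPow σ (Module.finrank K L) F ^ 1) := by
    rwa [pow_one]
  have hlead : g.coeff g.natDegree = 1 := hgmonic
  rw [mainTheorem8_general σ hσ F hFmonic hFirr k g hgdeg 1 hpow, hlead, map_one, mul_one]
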